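/- Let $F=F(X)$ be the free group on a finite set $X$, its elements being identified with the reduced words in $X\cup X^{-1}$, and let $C$ be a finitely generated subgroup of $F$. Let $\Gamma^*$ be the coset graph of $C$: its vertices are the right cosets $Cu$, $u\in F$, its base point $1$ is the coset $C$, and it has an edge labelled $x\in X$ from $Cu$ to $Cux$ for all $u$ and $x$. Let $v_w=Cw$ be the end of the path from $1$ with label $w$. Let $\Gamma\subseteq\Gamma^*$ be the subgroup graph of $C$, i.e. the union of all closed paths at $1$ without backtracking, and let $\partial^+\Gamma$ be the set of frontier vertices, i.e. the vertices of $\Gamma^*$ not in $\Gamma$ that are joined by an edge of $\Gamma^*$ (not in $\Gamma$) to a vertex of $\Gamma$. For $u \in F$ let $C(u)$ be the cone of all reduced words with initial segment $u$. Let $S$ be a Schreier transversal of $C$, i.e. a set of representatives, exactly one for each right coset of $C$, that is closed under taking initial segments of reduced words. Put $S_{\rm int}=\{s\in S: v_s\in V(\Gamma)\}$, $S_{\rm ext}=S\setminus S_{\rm int}$, $S_{\rm sin}=\{s\in S: s^{-1}Cs\cap C\neq 1\}$, and $S_{\rm uns}=\{s\in S: sc\notin S\text{ for some }c\in C\}$.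 Then $S=S_{T^*}$ for some spanning subtree $T^*$ of $\Gamma^*$, where $S_{T^*}$ is the set of labels of all paths without backtracking in $T^*$ that start at $1$, and the following hold. 1) $S_{\rm int}$ is finite, and $s\mapsto v_s$ is a bijection from $S_{\rm int}$ onto the vertex set $V(\Gamma)$; in particular $|S_{\rm int}|=|V(\Gamma)|$. 2) $S_{\rm ext}$ is the union of finitely many cones $C(u)$ with $v_u\in\partial^+\Gamma$. 3) $S_{\rm sin}$ is contained in a finite union of double cosets $Cs_1s_2^{-1}C$ with $s_1,s_2\in S_{\rm int}$. 4) $S_{\rm uns}$ is the intersection of $S$ with a finite union of left cosets $s_1s_2^{-1}C$ with $s_1,s_2\in S_{\rm int}$; in particular it is contained in such a finite union. -/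

import Mathlib

open scoped Pointwise

/-- A digraph with edges labelled by elements of `X`, whose vertices form a set of elements of `V`
(it has at most one edge with given label, initial vertex and terminal vertex). -/
structure LabeledDigraph (X V : Type*) where
  verts : Set V
  edge : V → X → V → Prop
  source_mem : ∀ {v x w}, edge v x w → v ∈ verts
  target_mem : ∀ {v x w}, edge v x w → w ∈ verts

namespace LabeledDigraph

variable {X V : Type*}

/-- One step of a path reading the letter `a`: the letter `(x, true)` stands for `x` and traverses an
edge labelled `x` along its orientation, the letter `(x, false)` stands for `x⁻¹` and traverses it in
the opposite direction. -/
def Step (G : LabeledDigraph X V) (v : V) (a : X × Bool) (w : V) : Prop :=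
  if a.2 then G.edge v a.1 w else G.edge w a.1 v

/-- There is a path in `G` from `v` to `w` with label `l`. -/
def Reads (G : LabeledDigraph X V) : List (X × Bool) → V → V → Prop
  | [], v, w => v ∈ G.verts ∧ v = w
  | a :: l, v, w => ∃ u, G.Step v a u ∧ G.Reads l u w

/-- The folded graph `G` with base point `o`: its core, i.e. the union of all closed paths at `o`
without backtracking. (In a folded graph, a path has no backtracking iff its label is reduced. An edge
that is traversed backwards by such a path is traversed forwards by the inverse path.) -/
def core (G : LabeledDigraph X V) (o : V) : LabeledDigraph X V where
  verts := {v | ∃ l₁ l₂, FreeGroup.IsReduced (l₁ ++ l₂) ∧ G.Reads l₁ o v ∧ G.Reads l₂ v o}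
  edge v x w := G.edge v x w ∧ ∃ l₁ l₂, FreeGroup.IsReduced (l₁ ++ (x, true) :: l₂) ∧
    G.Reads l₁ o v ∧ G.Reads l₂ w o
  source_mem := by
    rintro v x w ⟨he, l₁, l₂, hr, h₁, h₂⟩
    exact ⟨l₁, (x, true) :: l₂, hr, h₁, w, by simpa [Step] using he, h₂⟩
  target_mem := by
    rintro v x w ⟨he, l₁, l₂, hr, h₁, h₂⟩
    refine ⟨l₁ ++ [(x, true)], l₂, by simpa using hr, ?_, h₂⟩
    have key : ∀ (l : List (X × Bool)) (u : V), G.Reads l u v →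
        G.Reads (l ++ [(x, true)]) u w := by
      intro l
      induction l with
      | nil =>
        rintro u ⟨_, rfl⟩
        exact ⟨w, by simpa [Step] using he, G.target_mem he, rfl⟩
      | cons a l ih =>
        rintro u ⟨u', hs, hu⟩
        exact ⟨u', hs, ih u' hu⟩
    exact key l₁ o h₁

/-- `T` is a spanning subtree of the folded graph `G`: a subgraph containing all vertices of `G`,
connected, and without non-trivial closed paths without backtracking. -/
structure IsSpanningTree (T G : LabeledDigraph X V) : Prop where
  verts_eq : T.verts = G.verts
  edge_le : ∀ v x w, T.edge v x w → G.edge v x w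
  connected : ∀ v ∈ T.verts, ∀ w ∈ T.verts, ∃ l, T.Reads l v w
  acyclic : ∀ v l, FreeGroup.IsReduced l → T.Reads l v v → l = []

/-- The language accepted by `D` and `Y`: the set of labels of paths without backtracking in the
folded graph `D` from `o` to a vertex in `Y`. -/
def language [DecidableEq X] (D : LabeledDigraph X V) (Y : Set V) (o : V) : Set (FreeGroup X) :=
  {w | ∃ v ∈ Y, D.Reads w.toWord o v}

end LabeledDigraph

namespace FreeSubgroup

variable {X : Type*} (C : Subgroup (FreeGroup X))

/-- The set of right cosets `C u` of `C`. -/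
abbrev RightCosets : Type _ := Quotient (QuotientGroup.rightRel C)

/-- The right coset `C u`. -/
def coset (u : FreeGroup X) : RightCosets C := Quotient.mk (QuotientGroup.rightRel C) u

theorem coset_eq_iff {u v : FreeGroup X} : coset C u = coset C v ↔ v * u⁻¹ ∈ C :=
  Quotient.eq.trans QuotientGroup.rightRel_apply

/-- The coset graph of `C`: vertices are the right cosets, and there is an edge labelled `x` from
`C u` to `C u x`, for all `u` and all `x ∈ X`. -/
def cosetGraph : LabeledDigraph X (RightCosets C) where
  verts := Set.univ
  edge v x w := ∃ u, v = coset C u ∧ w = coset C (u * FreeGroup.of x)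
  source_mem _ := Set.mem_univ _
  target_mem _ := Set.mem_univ _

theorem cosetGraph_step_iff (u : FreeGroup X) (a : X × Bool) (w : RightCosets C) :
    (cosetGraph C).Step (coset C u) a w ↔ w = coset C (u * FreeGroup.mk [a]) := by
  obtain ⟨x, b⟩ := a
  cases b
  · have hx : (FreeGroup.mk [(x, false)] : FreeGroup X) = (FreeGroup.of x)⁻¹ := by
      simp [FreeGroup.of, FreeGroup.inv_mk, FreeGroup.invRev]
    simp only [LabeledDigraph.Step, cosetGraph, hx, Bool.false_eq_true, if_false]
    constructor
    · rintro ⟨t, rfl, ht⟩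
      rw [coset_eq_iff] at ht ⊢
      have := C.inv_mem ht
      simpa [mul_assoc] using this
    · rintro rfl
      exact ⟨_, rfl, by simp⟩
  · have hx : (FreeGroup.mk [(x, true)] : FreeGroup X) = FreeGroup.of x := rfl
    simp only [LabeledDigraph.Step, cosetGraph, hx, if_true]
    constructor
    · rintro ⟨t, ht, rfl⟩
      rw [coset_eq_iff] at ht ⊢
      have := C.inv_mem ht
      simpa [mul_assoc] using this
    · rintro rfl
      exact ⟨u, rfl, rfl⟩

/-- The path in the coset graph that starts at `C u` and has label `l` ends at `C u l`. -/
theorem cosetGraph_reads_iff (l : List (X × Bool)) (u : FreeGroup X) (w : RightCosets C) :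
    (cosetGraph C).Reads l (coset C u) w ↔ w = coset C (u * FreeGroup.mk l) := by
  induction l generalizing u with
  | nil =>
    simp [LabeledDigraph.Reads, cosetGraph, ← FreeGroup.one_eq_mk, eq_comm]
  | cons a l ih =>
    have : (FreeGroup.mk (a :: l) : FreeGroup X) = FreeGroup.mk [a] * FreeGroup.mk l := by
      simp [FreeGroup.mul_mk]
    simp only [LabeledDigraph.Reads, cosetGraph_step_iff, exists_eq_left, ih, this, mul_assoc]

/-- The base point `1` of the coset graph and of the subgroup graph: the coset `C`. -/
def base : RightCosets C := coset C 1

/-- The subgroup graph `Γ` of `C`, as a subgraph of the coset graph `Γ*`. -/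
def subgroupGraph : LabeledDigraph X (RightCosets C) := (cosetGraph C).core (base C)

/-- The end vertex `v_w = C w` of the path `p_w` in the coset graph that starts at `1` and has
label `w`. -/
def endVertex (w : FreeGroup X) : RightCosets C := coset C w

theorem reads_endVertex [DecidableEq X] (w : FreeGroup X) (v : RightCosets C) :
    (cosetGraph C).Reads w.toWord (base C) v ↔ v = endVertex C w := by
  simp [base, endVertex, cosetGraph_reads_iff, FreeGroup.mk_toWord]

/-- Vertices attached to `Γ` in building the coset graph: vertices of the coset graph, not in `Γ`, that
are the other end of an edge (outgoing if `a = (x, true)`, incoming if `a = (x, false)`) at a vertex `v`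
of `Γ` such that there is no such edge at `v` in `Γ`. -/
def frontier : Set (RightCosets C) :=
  {w | w ∉ (subgroupGraph C).verts ∧ ∃ v ∈ (subgroupGraph C).verts, ∃ a : X × Bool,
    (¬ ∃ u, (subgroupGraph C).Step v a u) ∧ (cosetGraph C).Step v a w}

/-- `S` is a Schreier transversal of `C`: every element of the free group is uniquely `c * s` with
`c ∈ C`, `s ∈ S`, and `S` is closed under initial segments (of reduced words). -/
def IsSchreierTransversal [DecidableEq X] (S : Set (FreeGroup X)) : Prop :=
  Subgroup.IsComplement (C : Set (FreeGroup X)) S ∧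
    ∀ s ∈ S, ∀ l, l <+: s.toWord → FreeGroup.mk l ∈ S

/-- The set `S_T` of labels of all paths without backtracking in `T` that start at `1`. -/
def treeTransversal [DecidableEq X] (T : LabeledDigraph X (RightCosets C)) : Set (FreeGroup X) :=
  T.language (cosetGraph C).verts (base C)

/-- Internal representatives. -/
def internal (S : Set (FreeGroup X)) : Set (FreeGroup X) :=
  {s ∈ S | endVertex C s ∈ (subgroupGraph C).verts}

/-- External representatives. -/
def external (S : Set (FreeGroup X)) : Set (FreeGroup X) := S \ internal C S

/-- The generalized normalizer `{f | f⁻¹ C f ∩ C ≠ 1}`. -/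
def generalizedNormalizer : Set (FreeGroup X) :=
  {f | C.map (MulAut.conj f⁻¹).toMonoidHom ⊓ C ≠ ⊥}

/-- Singular representatives. -/
def singular (S : Set (FreeGroup X)) : Set (FreeGroup X) := S ∩ generalizedNormalizer C

/-- Stable representatives. -/
def stable (S : Set (FreeGroup X)) : Set (FreeGroup X) := {s ∈ S | ∀ c ∈ C, s * c ∈ S}

/-- Unstable representatives. -/
def unstable (S : Set (FreeGroup X)) : Set (FreeGroup X) := S \ stable C S

/-- The cone based at `u`: all reduced words with initial segment `u`. -/
def cone [DecidableEq X] (u : FreeGroup X) : Set (FreeGroup X) := {w | u.toWord <+: w.toWord}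

end FreeSubgroup

/-!
The whole proof rests on one observation about cancellation. Write two reduced words as `p ++ r` and
`r⁻¹ ++ q`, where `r` is what cancels in their product, so that `p ++ q` is reduced
(`FreeGroup.IsReduced.exists_cancellation`). If the product lies in `C`, then `p ++ q` is the label of
a closed path at the base point without backtracking, so the vertex `C p` lies in the subgroup
graph `Γ`. Consequently two different reduced words that lead to the same vertex of the coset graph
diverge, read backwards, at a vertex of `Γ` (`exists_common_suffix`), and a path without backtracking
that has left `Γ` never returns to it (`coset_append_notMem`). If such a path has left `Γ` at the end
of a representative `s ∈ S`, then every reduced continuation of `s` is again in `S`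
(`IsSchreierTransversal.mk_append_mem`).

* The tree `T` has an edge `C s → C t` labelled `x` whenever `s, t ∈ S` and `t = s x`. A path in `T`
  multiplies representatives by its label, which makes `T` acyclic and gives `S = S_T`.
* `Γ` is finite because reducing a word only shortens the path that it labels, so that `Γ` has no
  vertices beyond those on the paths labelled by a finite generating set.
* The external representatives are covered by the cones at the points where they leave `Γ`.
* A closed path with cyclically reduced label has all its vertices in `Γ`, since otherwise it could be
  run through, in one of the two directions, as a continuation of the representative of its start
  (`IsSchreierTransversal.coset_mem_of_isCyclicallyReduced`). If `s c' = c s` with `1 ≠ c' ∈ C`, and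
  `c' = g k g⁻¹` with `k` cyclically reduced, then both `C g` and `C s g` lie in `Γ`; this is the
  claim on singular representatives.
* If `s c ∉ S` with `c ∈ C`, split `s = p r` and `c = r⁻¹ q` as above. Then `C r⁻¹` lies in `Γ` because
  `c ∈ C`, and `C p` lies in `Γ` because otherwise `s c = p q` would be in `S`; this is the claim on
  unstable representatives.
-/

open FreeGroup

/-! ### Reduced words -/

namespace FreeGroup

variable {X : Type*}

/-- In the product of two reduced words, a final segment `r` of the first one cancels against an
initial segment of the second one, and what remains is reduced. -/
theorem IsReduced.exists_cancellation {l₁ l₂ : List (X × Bool)} (h₁ : IsReduced l₁)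
    (h₂ : IsReduced l₂) :
    ∃ p r q, l₁ = p ++ r ∧ l₂ = invRev r ++ q ∧ IsReduced (p ++ q) := by
  induction l₁ using List.reverseRecOn generalizing l₂ with
  | nil => exact ⟨[], [], l₂, by simp, by simp, by simpa using h₂⟩
  | append_singleton l a ih =>
    by_cases h : ∃ l', l₂ = (a.1, !a.2) :: l'
    · obtain ⟨l', rfl⟩ := h
      obtain ⟨p, r, q, rfl, rfl, h⟩ := ih (l₂ := l') (h₁.infix ⟨[], [a], by simp⟩)
        (h₂.infix ⟨[(a.1, !a.2)], [], by simp⟩)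
      exact ⟨p, r ++ [a], q, by simp, by simp [invRev], h⟩
    · refine ⟨l ++ [a], [], l₂, by simp, by simp, ?_⟩
      refine List.isChain_append.2 ⟨h₁, h₂, ?_⟩
      rintro x hx ⟨y, b⟩ hy hxy
      obtain rfl : a = x := by simpa using hx
      by_contra hb
      refine h ⟨l₂.tail, ?_⟩
      rw [← List.cons_head?_tail hy]
      have : b = !a.2 := by
        revert hb
        cases a.2 <;> cases b <;> simp
      simp_all

theorem mk_append (l₁ l₂ : List (X × Bool)) : mk (l₁ ++ l₂) = mk l₁ * mk l₂ := mul_mk.symm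

theorem mk_invRev (l : List (X × Bool)) : mk (invRev l) = (mk l)⁻¹ := inv_mk.symm

theorem IsReduced.invRev {l : List (X × Bool)} (h : IsReduced l) : IsReduced (invRev l) := by
  classical
  rw [isReduced_iff_reduce_eq] at h ⊢
  rw [reduce_invRev, h]

theorem IsReduced.eq_nil_of_mk_eq_one {l : List (X × Bool)} (h : IsReduced l) (h1 : mk l = 1) :
    l = [] := by
  classical
  rw [← h.reduce_eq, ← toWord_mk, h1, toWord_one]

theorem IsReduced.of_prefix {l p : List (X × Bool)} (h : IsReduced l) (hp : p <+: l) :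
    IsReduced p := h.infix hp.isInfix

theorem prefix_append_iff {p l₁ l₂ : List (X × Bool)} :
    p <+: l₁ ++ l₂ ↔ p <+: l₁ ∨ ∃ q, p = l₁ ++ q ∧ q <+: l₂ := by
  constructor
  · rintro ⟨r, h⟩
    obtain ⟨a, rfl, -⟩ | ⟨a, rfl, rfl⟩ := List.append_eq_append_iff.1 h
    · exact .inl (List.prefix_append _ _)
    · exact .inr ⟨a, rfl, List.prefix_append _ _⟩
  · rintro (h | ⟨q, rfl, h⟩)
    · exact h.trans (List.prefix_append _ _)
    · simpa using h

/-- Reducing a word only cuts detours out of the path that it labels. -/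
theorem Red.exists_prefix {l₁ l₂ : List (X × Bool)} (h : Red l₁ l₂) {p : List (X × Bool)}
    (hp : p <+: l₂) : ∃ q, q <+: l₁ ∧ mk q = mk p := by
  induction h generalizing p with
  | refl => exact ⟨p, hp, rfl⟩
  | tail _ hs ih =>
    obtain @⟨A, B, x, b⟩ := hs
    rw [prefix_append_iff] at hp
    obtain hp | ⟨B', rfl, hB⟩ := hp
    · exact ih (hp.trans (List.prefix_append _ _))
    · obtain ⟨q, hq, h⟩ := ih (p := A ++ (x, b) :: (x, !b) :: B') (by simpa using hB)
      refine ⟨q, hq, h.trans ?_⟩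
      exact Quot.sound Red.Step.not

/-- A reduced word can be continued by a cyclically reduced word or by its inverse without
cancellation. -/
theorem IsReduced.append_or_append_invRev {l k : List (X × Bool)} (hl : IsReduced l)
    (hk : IsCyclicallyReduced k) : IsReduced (l ++ k) ∨ IsReduced (l ++ FreeGroup.invRev k) := by
  by_contra! h
  obtain ⟨h₁, h₂⟩ := h
  simp only [IsReduced, List.isChain_append, not_and] at h₁ h₂
  have h₁ := h₁ hl hk.1
  have h₂ := h₂ hl hk.1.invRev
  push Not at h₁ h₂
  obtain ⟨⟨x, a⟩, hx, ⟨y, b⟩, hy, hxy, hab⟩ := h₁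
  obtain ⟨⟨x', a'⟩, hx', ⟨z, c⟩, hz, hxz, hac⟩ := h₂
  obtain ⟨rfl, rfl⟩ : x = x' ∧ a = a' := by simpa using hx.symm.trans hx'
  have hz' : (z, !c) ∈ k.getLast? := by
    simp only [FreeGroup.invRev, List.head?_reverse, List.getLast?_map, Option.mem_def,
      Option.map_eq_some_iff, Prod.mk.injEq] at hz
    obtain ⟨⟨z', c'⟩, hz, rfl, rfl⟩ := hz
    simpa using hz
  have := hk.2 _ hz' _ hy
  simp only at *
  subst hxy hxz
  revert hab hac this
  cases a <;> cases b <;> cases c <;> simp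

end FreeGroup

namespace FreeSubgroup

variable {X : Type*} {C : Subgroup (FreeGroup X)}

/-! ### The subgroup graph -/

theorem coset_mul_left {c : FreeGroup X} (hc : c ∈ C) (u : FreeGroup X) :
    coset C (c * u) = coset C u := by
  rw [coset_eq_iff]
  simpa using C.inv_mem hc

theorem coset_mul_right {u v : FreeGroup X} (h : coset C u = coset C v) (w : FreeGroup X) :
    coset C (u * w) = coset C (v * w) := by
  rw [coset_eq_iff] at h ⊢
  simpa [mul_assoc] using h

theorem exists_coset_eq (v : RightCosets C) : ∃ u, coset C u = v := Quotient.exists_rep v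

/-- The vertices of the subgroup graph are the cosets of the initial segments of the reduced words
that represent elements of `C`. -/
theorem mem_subgroupGraph_verts {v : RightCosets C} :
    v ∈ (subgroupGraph C).verts ↔
      ∃ p q, IsReduced (p ++ q) ∧ mk (p ++ q) ∈ C ∧ v = coset C (mk p) := by
  have key (p q : List (X × Bool)) :
      (cosetGraph C).Reads q (coset C (mk p)) (base C) ↔ mk (p ++ q) ∈ C := by
    rw [cosetGraph_reads_iff, base, coset_eq_iff, mk_append]
    simp
  have key' (p : List (X × Bool)) (v : RightCosets C) :
      (cosetGraph C).Reads p (base C) v ↔ v = coset C (mk p) := by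
    rw [base, cosetGraph_reads_iff, one_mul]
  constructor
  · rintro ⟨p, q, h, hp, hq⟩
    obtain rfl := (key' _ _).1 hp
    exact ⟨p, q, h, (key _ _).1 hq, rfl⟩
  · rintro ⟨p, q, h, hC, rfl⟩
    exact ⟨p, q, h, (key' _ _).2 rfl, (key _ _).2 hC⟩

theorem coset_mem_of_prefix {l p : List (X × Bool)} (hl : IsReduced l) (hC : mk l ∈ C)
    (hp : p <+: l) : coset C (mk p) ∈ (subgroupGraph C).verts := by
  obtain ⟨q, rfl⟩ := hp
  exact mem_subgroupGraph_verts.2 ⟨p, q, hl, hC, rfl⟩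

theorem base_mem : coset C 1 ∈ (subgroupGraph C).verts :=
  coset_mem_of_prefix (l := []) (p := []) .nil C.one_mem List.prefix_rfl

/-- Two paths from the base point without backtracking that have the same end share their final
segments from some vertex of the subgroup graph on. -/
theorem exists_common_suffix {l₁ l₂ : List (X × Bool)} (h₁ : IsReduced l₁) (h₂ : IsReduced l₂)
    (h : coset C (mk l₁) = coset C (mk l₂)) :
    ∃ p q r, l₁ = p ++ r ∧ l₂ = q ++ r ∧ coset C (mk p) = coset C (mk q) ∧
      coset C (mk p) ∈ (subgroupGraph C).verts := by
  obtain ⟨p, r, q, rfl, h₂', hpq⟩ := h₁.exists_cancellation h₂.invRev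
  obtain rfl : l₂ = invRev q ++ r := by
    rw [← invRev_invRev (L₁ := l₂), h₂', invRev_append, invRev_invRev]
  have hC : mk (p ++ q) ∈ C := by
    rw [eq_comm, coset_eq_iff] at h
    simpa [-mul_mk, -inv_mk, mk_append, mk_invRev, mul_assoc] using h
  refine ⟨p, invRev q, r, rfl, rfl, ?_, coset_mem_of_prefix hpq hC (List.prefix_append _ _)⟩
  rw [eq_comm, coset_eq_iff]
  simpa [-mul_mk, -inv_mk, mk_append, mk_invRev] using hC

/-- A path without backtracking that has left the subgroup graph does not return to it. -/
theorem coset_append_notMem {l m : List (X × Bool)} (h : IsReduced (l ++ m))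
    (hl : coset C (mk l) ∉ (subgroupGraph C).verts) :
    coset C (mk (l ++ m)) ∉ (subgroupGraph C).verts := by
  intro hm
  obtain ⟨l₁, l₂, h₁₂, hC, heq⟩ := mem_subgroupGraph_verts.1 hm
  obtain ⟨p, r, q, hp, rfl, hpq⟩ := h.exists_cancellation (l₂ := l₂) (h₁₂.infix ⟨l₁, [], by simp⟩)
  have hC' : mk (p ++ q) ∈ C := by
    have := (coset_mul_right heq (mk (invRev r ++ q))).symm
    rw [← mk_append l₁, coset_eq_iff, hp] at this
    simpa [-mul_mk, -inv_mk, mk_append, mk_invRev, mul_assoc] using C.mul_mem this hC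
  obtain ⟨a, rfl, rfl⟩ | ⟨a, rfl, rfl⟩ := List.append_eq_append_iff.1 hp
  · exact hl (coset_mem_of_prefix hpq hC' (by simp))
  · -- The closed path `l₁ ++ l₂` begins its way back by retracing `m`, and so it visits the end of `l`.
    refine hl ?_
    have : coset C (mk (l₁ ++ invRev m)) = coset C (mk (p ++ a)) := by
      rw [mk_append, ← coset_mul_right heq]
      simp [-mul_mk, -inv_mk, mk_append, mk_invRev, mul_assoc]
    rw [← this]
    refine coset_mem_of_prefix h₁₂ hC ⟨invRev a ++ q, by simp [invRev_append]⟩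

/-- The subgroup graph of a finitely generated subgroup is finite. -/
theorem finite_subgroupGraph_verts (hC : C.FG) : (subgroupGraph C).verts.Finite := by
  classical
  obtain ⟨A, rfl⟩ := hC
  set C := Subgroup.closure (A : Set (FreeGroup X))
  set K : Set (RightCosets C) := insert (coset C 1)
    (⋃ a ∈ A, (fun p => coset C (mk p)) '' {p | p ∈ a.toWord.inits})
  have hK : K.Finite :=
    (A.finite_toSet.biUnion fun a _ => (List.finite_toSet _).image _).insert _
  refine hK.subset fun v hv => ?_
  have key : ∀ c ∈ C, ∀ p, p <+: c.toWord → coset C (mk p) ∈ K := by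
    intro c hc
    induction hc using Subgroup.closure_induction with
    | mem a ha =>
      intro p hp
      exact .inr (Set.mem_biUnion ha ⟨p, by simpa using hp, rfl⟩)
    | one =>
      intro p hp
      obtain rfl : p = [] := by simpa using hp
      exact .inl rfl
    | mul a b ha hb iha ihb =>
      intro p hp
      rw [toWord_mul] at hp
      obtain ⟨q, hq, hqp⟩ := reduce.red.exists_prefix hp
      rw [← hqp]
      rw [prefix_append_iff] at hq
      obtain hq | ⟨q, rfl, hq⟩ := hq
      · exact iha _ hq
      · rw [mk_append, mk_toWord, coset_mul_left ha]
        exact ihb _ hq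
    | inv a ha ih =>
      rintro p ⟨q, hq⟩
      have hq' : invRev q ++ invRev p = a.toWord := by
        rw [← invRev_append, hq, toWord_inv, invRev_invRev]
      have : coset C (mk p) = coset C (mk (invRev q)) := by
        have hpq : mk (p ++ q) = a⁻¹ := by rw [hq, mk_toWord]
        rw [eq_comm, coset_eq_iff, mk_invRev, inv_inv, ← mk_append, hpq]
        exact C.inv_mem ha
      rw [this]
      exact ih _ ⟨_, hq'⟩
  obtain ⟨p, q, h, hpq, rfl⟩ := mem_subgroupGraph_verts.1 hv
  refine key _ hpq p ?_
  rw [toWord_mk, h.reduce_eq]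
  exact List.prefix_append _ _

theorem finite_frontier [Finite X] (hC : C.FG) : (frontier C).Finite := by
  have : (⋃ v ∈ (subgroupGraph C).verts, ⋃ a : X × Bool,
      {w | (cosetGraph C).Step v a w}).Finite := by
    refine (finite_subgroupGraph_verts hC).biUnion fun v _ => Set.finite_iUnion fun a => ?_
    obtain ⟨u, rfl⟩ := exists_coset_eq v
    simp [cosetGraph_step_iff]
  refine this.subset ?_
  rintro w ⟨-, v, hv, a, -, h⟩
  simp only [Set.mem_iUnion]
  exact ⟨v, hv, a, h⟩

/-- A path without backtracking from the base point to a vertex outside the subgroup graph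
crosses the frontier. -/
theorem exists_prefix_mem_frontier {l : List (X × Bool)}
    (h : coset C (mk l) ∉ (subgroupGraph C).verts) :
    ∃ p, p <+: l ∧ coset C (mk p) ∈ frontier C := by
  induction l using List.reverseRecOn with
  | nil => exact absurd base_mem h
  | append_singleton l a ih =>
    by_cases hl : coset C (mk l) ∈ (subgroupGraph C).verts
    · have hstep : (cosetGraph C).Step (coset C (mk l)) a (coset C (mk (l ++ [a]))) := by
        rw [cosetGraph_step_iff, mk_append]
      refine ⟨_, List.prefix_rfl, h, _, hl, a, ?_, hstep⟩
      rintro ⟨u, hu⟩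
      have hu' : (cosetGraph C).Step (coset C (mk l)) a u ∧ u ∈ (subgroupGraph C).verts := by
        unfold LabeledDigraph.Step at hu ⊢
        split_ifs at hu ⊢
        · exact ⟨hu.1, (subgroupGraph C).target_mem hu⟩
        · exact ⟨hu.1, (subgroupGraph C).source_mem hu⟩
      rw [cosetGraph_step_iff, ← mk_append] at hu'
      exact h (hu'.1 ▸ hu'.2)
    · obtain ⟨p, hp, hf⟩ := ih hl
      exact ⟨p, hp.trans (List.prefix_append _ _), hf⟩

/-! ### Schreier transversals -/

namespace IsSchreierTransversal

variable [DecidableEq X] {S : Set (FreeGroup X)}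

theorem exists_mem_coset_eq (hS : IsSchreierTransversal C S) (v : RightCosets C) :
    ∃ s ∈ S, coset C s = v := by
  obtain ⟨⟨s, hs⟩, h, -⟩ := Subgroup.isComplement_subgroup_left_iff_existsUnique_quotientMk''.1 hS.1 v
  exact ⟨s, hs, h⟩

theorem injOn_coset (hS : IsSchreierTransversal C S) : Set.InjOn (coset C) S := by
  intro s hs t ht h
  have := (Subgroup.isComplement_subgroup_left_iff_existsUnique_quotientMk''.1 hS.1
    (coset C t)).unique (y₁ := ⟨s, hs⟩) (y₂ := ⟨t, ht⟩) h rfl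
  simpa using this

theorem mk_mem_of_prefix (hS : IsSchreierTransversal C S) {l p : List (X × Bool)}
    (hl : IsReduced l) (hlS : mk l ∈ S) (hp : p <+: l) : mk p ∈ S :=
  hS.2 _ hlS p (by rwa [toWord_mk, hl.reduce_eq])

theorem one_mem (hS : IsSchreierTransversal C S) : 1 ∈ S := by
  obtain ⟨s, hs, -⟩ := hS.exists_mem_coset_eq (coset C 1)
  exact hS.2 s hs [] List.nil_prefix

/-- Every reduced continuation of an external representative is a representative. -/
theorem mk_append_mem (hS : IsSchreierTransversal C S) {l m : List (X × Bool)}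
    (h : IsReduced (l ++ m)) (hlS : mk l ∈ S) (hl : coset C (mk l) ∉ (subgroupGraph C).verts) :
    mk (l ++ m) ∈ S := by
  obtain ⟨s, hs, hsl⟩ := hS.exists_mem_coset_eq (coset C (mk (l ++ m)))
  obtain ⟨p, q, r, hp, hq, hpq, hΓ⟩ := exists_common_suffix (C := C) h (isReduced_toWord (x := s))
    (by rw [mk_toWord, hsl])
  have hlr : IsReduced l := h.infix ⟨[], m, by simp⟩
  -- The two paths join at the end of `p`, which has to lie before the end of `l`.
  obtain ⟨a, rfl, -⟩ | ⟨a, rfl, -⟩ := List.append_eq_append_iff.1 hp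
  · exact absurd hΓ (coset_append_notMem (h.of_prefix ⟨r, hp.symm⟩) hl)
  · have hqS : mk q ∈ S := hS.2 s hs q ⟨r, hq.symm⟩
    have hpS : mk p ∈ S := hS.mk_mem_of_prefix hlr hlS (List.prefix_append _ _)
    have : mk (p ++ a ++ m) = s := by
      rw [hp, mk_append, hS.injOn_coset hpS hqS hpq, ← mk_append, ← hq, mk_toWord]
    rwa [this]

/-- A closed path with non-trivial cyclically reduced label starts in the subgroup graph. -/
theorem coset_mem_of_isCyclicallyReduced (hS : IsSchreierTransversal C S) {k : List (X × Bool)}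
    (hk : IsCyclicallyReduced k) (hk₀ : k ≠ []) {g : FreeGroup X}
    (h : coset C (g * mk k) = coset C g) : coset C g ∈ (subgroupGraph C).verts := by
  by_contra hg
  obtain ⟨s, hs, hsg⟩ := hS.exists_mem_coset_eq (coset C g)
  have key (m : List (X × Bool)) (hm : IsReduced (s.toWord ++ m))
      (hgm : coset C (g * mk m) = coset C g) : m = [] := by
    have hmS : mk (s.toWord ++ m) ∈ S :=
      hS.mk_append_mem hm (by rwa [mk_toWord]) (by rwa [mk_toWord, hsg])
    have : mk (s.toWord ++ m) = s := by
      refine hS.injOn_coset hmS hs ?_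
      rw [mk_append, mk_toWord, coset_mul_right hsg, hgm, hsg]
    rw [mk_append, mk_toWord, mul_eq_left] at this
    exact (hm.infix ⟨s.toWord, [], by simp⟩).eq_nil_of_mk_eq_one this
  obtain hred | hred := IsReduced.append_or_append_invRev (isReduced_toWord (x := s)) hk
  · exact hk₀ (key _ hred h)
  · refine hk₀ ?_
    have := key _ hred (by simpa [-mul_mk, -inv_mk, mk_invRev] using (coset_mul_right h (mk k)⁻¹).symm)
    rw [← invRev_invRev (L₁ := k), this, invRev_empty]

end IsSchreierTransversal

/-! ### The spanning tree of a Schreier transversal -/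

/-- The graph spanned by a set `S` of coset representatives: all edges of the coset graph that join
the cosets of two elements of `S` which differ by the label of the edge. -/
def transversalGraph (C : Subgroup (FreeGroup X)) (S : Set (FreeGroup X)) :
    LabeledDigraph X (RightCosets C) where
  verts := Set.univ
  edge v x w := ∃ s ∈ S, s * of x ∈ S ∧ v = coset C s ∧ w = coset C (s * of x)
  source_mem _ := Set.mem_univ _
  target_mem _ := Set.mem_univ _

theorem mk_singleton_false (x : X) : (mk [(x, false)] : FreeGroup X) = (of x)⁻¹ := by
  simp [of, inv_mk, FreeGroup.invRev]

theorem transversalGraph_step {S : Set (FreeGroup X)} (hS : Set.InjOn (coset C) S)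
    {s : FreeGroup X} (hs : s ∈ S) (a : X × Bool) (w : RightCosets C) :
    (transversalGraph C S).Step (coset C s) a w ↔ s * mk [a] ∈ S ∧ w = coset C (s * mk [a]) := by
  obtain ⟨x, b⟩ := a
  cases b
  · simp only [LabeledDigraph.Step, transversalGraph, Bool.false_eq_true, if_false,
      mk_singleton_false]
    constructor
    · rintro ⟨t, ht, htx, rfl, h⟩
      obtain rfl := hS hs htx h
      simpa using ht
    · rintro ⟨h, rfl⟩
      exact ⟨_, h, by simpa using hs, rfl, by simp⟩
  · simp only [LabeledDigraph.Step, transversalGraph, if_true]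
    constructor
    · rintro ⟨t, ht, htx, h, rfl⟩
      obtain rfl := hS hs ht h
      exact ⟨htx, rfl⟩
    · rintro ⟨h, rfl⟩
      exact ⟨s, hs, h, rfl, rfl⟩

/-- A path in the graph spanned by `S` amounts to a sequence of elements of `S`, each of which is
the product of the preceding one with a letter. -/
theorem transversalGraph_reads {S : Set (FreeGroup X)} (hS : Set.InjOn (coset C) S)
    {s : FreeGroup X} (hs : s ∈ S) (l : List (X × Bool)) (w : RightCosets C) :
    (transversalGraph C S).Reads l (coset C s) w ↔
      (∀ p, p <+: l → s * mk p ∈ S) ∧ w = coset C (s * mk l) := by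
  induction l generalizing s with
  | nil => simp [LabeledDigraph.Reads, transversalGraph, ← one_eq_mk, hs, eq_comm]
  | cons a l ih =>
    have hcons (p : List (X × Bool)) : s * mk (a :: p) = s * mk [a] * mk p := by
      rw [mul_assoc, mul_mk]; rfl
    simp only [LabeledDigraph.Reads, transversalGraph_step hS hs]
    constructor
    · rintro ⟨_, ⟨h, rfl⟩, hl⟩
      obtain ⟨hp, rfl⟩ := (ih h).1 hl
      refine ⟨?_, by rw [hcons l]⟩
      rintro p hpl
      obtain rfl | ⟨p, rfl, hpl'⟩ := List.prefix_cons_iff.1 hpl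
      · simpa [← one_eq_mk] using hs
      · rw [hcons]
        exact hp p hpl'
    · rintro ⟨hp, rfl⟩
      have h : s * mk [a] ∈ S := hp [a] (by simp)
      refine ⟨_, ⟨h, rfl⟩, (ih h).2 ⟨fun p hpl => ?_, by rw [hcons l]⟩⟩
      rw [← hcons]
      exact hp _ ((List.prefix_cons_inj a).2 hpl)

namespace IsSchreierTransversal

variable [DecidableEq X] {S : Set (FreeGroup X)}

theorem isSpanningTree_transversalGraph (hS : IsSchreierTransversal C S) :
    (transversalGraph C S).IsSpanningTree (cosetGraph C) where
  verts_eq := rfl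
  edge_le := by
    rintro v x w ⟨s, -, -, rfl, rfl⟩
    exact ⟨s, rfl, rfl⟩
  connected := by
    intro v _ w _
    obtain ⟨s, hs, rfl⟩ := hS.exists_mem_coset_eq v
    obtain ⟨t, ht, rfl⟩ := hS.exists_mem_coset_eq w
    refine ⟨invRev s.toWord ++ t.toWord, (transversalGraph_reads hS.injOn_coset hs _ _).2
      ⟨fun p hp => ?_, by simp [-mul_mk, -inv_mk, mk_append, mk_invRev, mk_toWord]⟩⟩
    obtain ⟨q, hq⟩ | ⟨p, rfl, hp'⟩ := prefix_append_iff.1 hp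
    · have hq' : invRev q ++ invRev p = s.toWord := by
        rw [← invRev_append, hq, invRev_invRev]
      have : s * mk p = mk (invRev q) := by
        rw [← mk_toWord (x := s), ← hq', mk_append, mk_invRev p, inv_mul_cancel_right]
      rw [this]
      exact hS.2 s hs _ ⟨_, hq'⟩
    · rw [mk_append, mk_invRev, mk_toWord, mul_inv_cancel_left]
      exact hS.2 t ht p hp'
  acyclic := by
    intro v l hl h
    obtain ⟨s, hs, rfl⟩ := hS.exists_mem_coset_eq v
    obtain ⟨hp, h⟩ := (transversalGraph_reads hS.injOn_coset hs _ _).1 h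
    have := hS.injOn_coset hs (hp l List.prefix_rfl) h
    exact hl.eq_nil_of_mk_eq_one (by simpa using this)

theorem eq_treeTransversal (hS : IsSchreierTransversal C S) :
    S = treeTransversal C (transversalGraph C S) := by
  ext w
  have key (v : RightCosets C) := transversalGraph_reads hS.injOn_coset hS.one_mem w.toWord v
  simp only [one_mul] at key
  constructor
  · intro hw
    exact ⟨_, Set.mem_univ _, (key _).2 ⟨fun p hp => hS.2 w hw p hp, rfl⟩⟩
  · rintro ⟨v, -, h⟩
    have := ((key _).1 h).1 _ List.prefix_rfl
    rwa [mk_toWord] at this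

/-! ### Internal, external, singular and unstable representatives -/

theorem bijOn_internal (hS : IsSchreierTransversal C S) :
    Set.BijOn (endVertex C) (internal C S) (subgroupGraph C).verts := by
  refine ⟨fun s hs => hs.2, hS.injOn_coset.mono fun s hs => hs.1, fun v hv => ?_⟩
  obtain ⟨s, hs, rfl⟩ := hS.exists_mem_coset_eq v
  exact ⟨s, ⟨hs, hv⟩, rfl⟩

theorem finite_internal (hS : IsSchreierTransversal C S) (hC : C.FG) : (internal C S).Finite :=
  hS.bijOn_internal.finite_iff_finite.2 (finite_subgroupGraph_verts hC)

theorem external_eq (hS : IsSchreierTransversal C S) :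
    external C S = ⋃ u ∈ {u ∈ S | endVertex C u ∈ frontier C}, cone u := by
  ext w
  simp only [Set.mem_iUnion, exists_prop]
  constructor
  · rintro ⟨hw, hw'⟩
    have hwΓ : coset C (mk w.toWord) ∉ (subgroupGraph C).verts := by
      rw [mk_toWord]
      exact fun h => hw' ⟨hw, h⟩
    obtain ⟨p, hp, hf⟩ := exists_prefix_mem_frontier hwΓ
    refine ⟨mk p, ⟨hS.2 w hw p hp, hf⟩, ?_⟩
    rwa [cone, Set.mem_ofPred_eq, toWord_mk, (isReduced_toWord.of_prefix hp).reduce_eq]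
  · rintro ⟨u, ⟨hu, hf⟩, m, hm⟩
    have hred : IsReduced (u.toWord ++ m) := hm ▸ isReduced_toWord
    have huΓ : coset C (mk u.toWord) ∉ (subgroupGraph C).verts := by
      rw [mk_toWord]
      exact hf.1
    have h₁ := hS.mk_append_mem hred (by rwa [mk_toWord]) huΓ
    have h₂ := coset_append_notMem hred huΓ
    rw [hm, mk_toWord] at h₁ h₂
    exact ⟨h₁, fun h => h₂ h.2⟩

theorem exists_internal (hS : IsSchreierTransversal C S) {g : FreeGroup X}
    (hg : coset C g ∈ (subgroupGraph C).verts) : ∃ t ∈ internal C S, ∃ c ∈ C, g = c * t := by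
  obtain ⟨t, ht, htg⟩ := hS.exists_mem_coset_eq (coset C g)
  exact ⟨t, ⟨ht, by rwa [endVertex, htg]⟩, g * t⁻¹, (coset_eq_iff C).1 htg, by simp⟩

theorem exists_mem_doubleCoset_of_singular (hS : IsSchreierTransversal C S) {s : FreeGroup X}
    (hs : s ∈ singular C S) : ∃ s₁ ∈ internal C S, ∃ s₂ ∈ internal C S,
      s ∈ DoubleCoset.doubleCoset (s₁ * s₂⁻¹) (C : Set (FreeGroup X)) C := by
  obtain ⟨⟨c', ⟨c, hc, hcc'⟩, hc'⟩, hne⟩ := Subgroup.ne_bot_iff_exists_ne_one.1 hs.2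
  have hne : c' ≠ 1 := fun h => hne (Subtype.ext h)
  have hsc : s * c' = c * s := by
    rw [← hcc']
    simp [mul_assoc]
  set g := mk (reduceCyclically.conjugator c'.toWord)
  set k := reduceCyclically c'.toWord
  have hg : g * mk k * g⁻¹ = c' := by
    rw [← mk_invRev, ← mk_append, ← mk_append,
      reduceCyclically.conj_conjugator_reduceCyclically, mk_toWord]
  have hk : IsCyclicallyReduced k := reduceCyclically.isCyclicallyReduced isReduced_toWord
  have hk₀ : k ≠ [] := by
    intro h
    rw [h, ← one_eq_mk] at hg
    exact hne (by simpa using hg.symm)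
  have hgk : g * mk k = c' * g := by rw [← hg, inv_mul_cancel_right]
  have h₁ : coset C (s * g) ∈ (subgroupGraph C).verts := by
    refine hS.coset_mem_of_isCyclicallyReduced hk hk₀ ?_
    rw [mul_assoc, hgk, ← mul_assoc, hsc, mul_assoc, coset_mul_left hc]
  have h₂ : coset C g ∈ (subgroupGraph C).verts := by
    refine hS.coset_mem_of_isCyclicallyReduced hk hk₀ ?_
    rw [hgk, coset_mul_left hc']
  obtain ⟨s₁, hs₁, d, hd, hd'⟩ := hS.exists_internal h₁
  obtain ⟨s₂, hs₂, e, he, he'⟩ := hS.exists_internal h₂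
  refine ⟨s₁, hs₁, s₂, hs₂, DoubleCoset.mem_doubleCoset.2 ⟨d, hd, e⁻¹, C.inv_mem he, ?_⟩⟩
  rw [eq_mul_inv_of_mul_eq hd', he']
  simp [mul_assoc]

theorem exists_mem_leftCoset_of_unstable (hS : IsSchreierTransversal C S) {s : FreeGroup X}
    (hs : s ∈ unstable C S) : ∃ s₁ ∈ internal C S, ∃ s₂ ∈ internal C S,
      s ∈ (s₁ * s₂⁻¹) • (C : Set (FreeGroup X)) := by
  obtain ⟨hsS, hs⟩ := hs
  obtain ⟨c, hc, hsc⟩ : ∃ c ∈ C, s * c ∉ S := by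
    by_contra! h
    exact hs ⟨hsS, h⟩
  obtain ⟨p, r, q, hp, hq, hpq⟩ :=
    (isReduced_toWord (x := s)).exists_cancellation (isReduced_toWord (x := c))
  have hs' : s = mk p * mk r := by rw [← mk_append, ← hp, mk_toWord]
  have hc' : c = (mk r)⁻¹ * mk q := by rw [← mk_invRev, ← mk_append, ← hq, mk_toWord]
  have hpS : mk p ∈ S := hS.2 s hsS p ⟨r, hp.symm⟩
  have hpΓ : coset C (mk p) ∈ (subgroupGraph C).verts := by
    by_contra hpΓ
    refine hsc ?_
    have := hS.mk_append_mem hpq hpS hpΓ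
    rwa [mk_append, ← mul_inv_cancel_left (mk r) (mk q), ← hc', ← mul_assoc, ← hs'] at this
  have hrΓ : coset C (mk r)⁻¹ ∈ (subgroupGraph C).verts := by
    rw [← mk_invRev]
    exact coset_mem_of_prefix isReduced_toWord (by rwa [mk_toWord]) ⟨q, hq.symm⟩
  obtain ⟨t, ht, d, hd, hrt⟩ := hS.exists_internal hrΓ
  refine ⟨mk p, ⟨hpS, hpΓ⟩, t, ht, Set.mem_smul_set.2 ⟨d⁻¹, C.inv_mem hd, ?_⟩⟩
  rw [hs', ← inv_inv (mk r), hrt]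
  simp [mul_assoc]

end IsSchreierTransversal

end FreeSubgroup

theorem mainTheorem9 {X : Type*} [Finite X] [DecidableEq X]
    (C : Subgroup (FreeGroup X)) (hC : C.FG)
    (S : Set (FreeGroup X)) (hS : FreeSubgroup.IsSchreierTransversal C S) :
    -- `S` is given by a spanning subtree of the coset graph
    (∃ T : LabeledDigraph X (FreeSubgroup.RightCosets C),
      T.IsSpanningTree (FreeSubgroup.cosetGraph C) ∧ S = FreeSubgroup.treeTransversal C T) ∧
    -- internal representatives
    ((FreeSubgroup.internal C S).Finite ∧
      Set.BijOn (FreeSubgroup.endVertex C) (FreeSubgroup.internal C S)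
        (FreeSubgroup.subgroupGraph C).verts) ∧
    -- external representatives
    (∃ U : Set (FreeGroup X), U.Finite ∧
      (∀ u ∈ U, FreeSubgroup.endVertex C u ∈ FreeSubgroup.frontier C) ∧
      FreeSubgroup.external C S = ⋃ u ∈ U, FreeSubgroup.cone u) ∧
    -- singular representatives
    (∃ P : Set (FreeGroup X × FreeGroup X), P.Finite ∧
      P ⊆ FreeSubgroup.internal C S ×ˢ FreeSubgroup.internal C S ∧
      FreeSubgroup.singular C S ⊆
        ⋃ p ∈ P, DoubleCoset.doubleCoset (p.1 * p.2⁻¹) (C : Set (FreeGroup X)) C) ∧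
    -- unstable representatives
    (∃ Q : Set (FreeGroup X × FreeGroup X), Q.Finite ∧
      Q ⊆ FreeSubgroup.internal C S ×ˢ FreeSubgroup.internal C S ∧
      FreeSubgroup.unstable C S =
        S ∩ ⋃ q ∈ Q, (q.1 * q.2⁻¹) • (C : Set (FreeGroup X))) := by
  refine ⟨⟨_, hS.isSpanningTree_transversalGraph, hS.eq_treeTransversal⟩,
    ⟨hS.finite_internal hC, hS.bijOn_internal⟩,
    ⟨{u ∈ S | FreeSubgroup.endVertex C u ∈ FreeSubgroup.frontier C}, ?_, fun u hu => hu.2,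
      hS.external_eq⟩,
    ⟨FreeSubgroup.internal C S ×ˢ FreeSubgroup.internal C S,
      (hS.finite_internal hC).prod (hS.finite_internal hC), subset_rfl, fun s hs => ?_⟩,
    -- Within `S`, instability only depends on the left coset, so it suffices to take the pairs
    -- whose left coset contains an unstable representative.
    ⟨{q ∈ FreeSubgroup.internal C S ×ˢ FreeSubgroup.internal C S |
        ∃ s ∈ FreeSubgroup.unstable C S, s ∈ (q.1 * q.2⁻¹) • (C : Set (FreeGroup X))},
      ((hS.finite_internal hC).prod (hS.finite_internal hC)).subset (Set.sep_subset _ _),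
      Set.sep_subset _ _, ?_⟩⟩
  · exact Set.Finite.of_finite_image ((FreeSubgroup.finite_frontier hC).subset
      (Set.image_subset_iff.2 fun u hu => hu.2)) (hS.injOn_coset.mono fun u hu => hu.1)
  · obtain ⟨s₁, h₁, s₂, h₂, h⟩ := hS.exists_mem_doubleCoset_of_singular hs
    exact Set.mem_biUnion (x := (s₁, s₂)) ⟨h₁, h₂⟩ h
  · refine Set.Subset.antisymm (fun s hs => ⟨hs.1, ?_⟩) ?_
    · obtain ⟨s₁, h₁, s₂, h₂, h⟩ := hS.exists_mem_leftCoset_of_unstable hs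
      exact Set.mem_biUnion (x := (s₁, s₂)) ⟨⟨h₁, h₂⟩, s, hs, h⟩ h
    · rintro t ⟨ht, htQ⟩
      simp only [Set.mem_iUnion] at htQ
      obtain ⟨q, ⟨-, s, hs, hsq⟩, htq⟩ := htQ
      refine ⟨ht, fun hst => hs.2 ⟨hs.1, fun c hc => ?_⟩⟩
      obtain ⟨d, hd, rfl⟩ := hsq
      obtain ⟨e, he, rfl⟩ := htq
      have := hst.2 (e⁻¹ * (d * c)) (C.mul_mem (C.inv_mem he) (C.mul_mem hd hc))
      simpa [mul_assoc] using this
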